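/- \textbf{Theorem 4.} For a set $V$ of $n$ vertices, a set $P\subseteq V$, a linear ordering of $V\setminus P$ and $p\in[0,1/2]$, the planted directed random graph $D$ on $V$ is obtained as follows. Each unordered pair of distinct vertices with at least one vertex in $P$ is adjacent with probability $2p$, and an adjacent such pair receives exactly one arc, in one of the two directions with equal probability. For each pair of vertices of $V\setminus P$, the arc that goes forward in the ordering is present with probability $p$, and no backward arc occurs. All these choices are independent. Let $D_{n,\delta,p}$ denote this graph when $P$ has size $\delta n$ (rounded up or down to an integer) and $P$ and the ordering of $V\setminus P$ are otherwise arbitrary. Let $k\ge 3$ be an integer, let $C>0$ and $0<\delta\le 9/19$ be constants, and let $C/n^{1-2/k}\le p\le 1/2$. Then, with high probability, $P$ is the unique smallest hitting set for the directed simple cycles with exactly $k$ vertices in $D_{n,\delta,p}$; that is, $P$ meets the vertex set of every such cycle, and every other set of vertices with this property has more than $|P|$ elements. Here "with high probability" means with probability tending to $1$ as $n\to\infty$, uniformly over all choices of $P$, of the ordering and of $p$ as above. -/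

import Mathlib

open MeasureTheory

namespace PlantedFVS

/-! ### Cycles and hitting sets -/

/-- The vertex sets of the directed simple cycles with exactly `k` vertices of a digraph:
`k` distinct vertices, indexed cyclically, each with an arc to the next one. -/
def cycleSets {V : Type*} (D : Digraph V) (k : ℕ) : Set (Finset V) :=
  {T | ∃ c : ZMod k → V, Function.Injective c ∧ (∀ i, D.Adj (c i) (c (i + 1))) ∧
    (T : Set V) = Set.range c}

/-- `H` meets every member of the family `𝒯`. -/
def IsHittingSet {V : Type*} (𝒯 : Set (Finset V)) (H : Finset V) : Prop :=
  ∀ T ∈ 𝒯, ∃ v ∈ H, v ∈ T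

/-- `H` is the (unique) smallest hitting set of `𝒯`: it is a hitting set, and every other
hitting set has strictly more elements. -/
def IsTheSmallestHittingSet {V : Type*} (𝒯 : Set (Finset V)) (H : Finset V) : Prop :=
  IsHittingSet 𝒯 H ∧ ∀ H' : Finset V, IsHittingSet 𝒯 H' → H' ≠ H → H.card < H'.card

/-! ### The planted directed random graph -/

/-- For every unordered pair of vertices two Boolean outcomes: whether the pair is adjacent, and
an orientation (`true` meaning from the smaller to the larger label). The outcomes attached to
the diagonal pairs `{v, v}` are never used. -/
abbrev Outcome (n : ℕ) : Type := Sym2 (Fin n) → Bool × Bool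

/-- The adjacency probability of a pair: `2p` if it has a vertex in `P`, and `p` otherwise. -/
def adjProb {n : ℕ} (P : Finset (Fin n)) (p : Set.Icc (0 : ℝ) (1 / 2)) (e : Sym2 (Fin n)) :
    unitInterval :=
  if ∃ u ∈ P, u ∈ e then
    ⟨2 * (p : ℝ), Set.mem_Icc.2 ⟨by linarith [p.2.1], by linarith [p.2.2]⟩⟩
  else
    ⟨(p : ℝ), Set.mem_Icc.2 ⟨p.2.1, by linarith [p.2.2]⟩⟩

/-- All outcomes are independent; a pair is adjacent with probability `adjProb P p`, and its
orientation is a fair coin. -/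
noncomputable def plantedMeasure {n : ℕ} (P : Finset (Fin n)) (p : Set.Icc (0 : ℝ) (1 / 2)) :
    Measure (Outcome n) :=
  Measure.pi fun e =>
    (ProbabilityTheory.bernoulliMeasure true false (adjProb P p e)).prod
      (ProbabilityTheory.bernoulliMeasure true false
        ⟨1 / 2, Set.mem_Icc.2 ⟨by norm_num, by norm_num⟩⟩)

/-- The planted directed random graph with planted set `P` and ordering `σ` of the other
vertices. An adjacent pair with a vertex in `P` is oriented by its coin; an adjacent pair of
vertices outside `P` gets the arc that goes forward in the ordering `σ`. -/
def plantedDigraph {n : ℕ} (P : Finset (Fin n)) (σ : {v : Fin n // v ∉ P} ≃ Fin (n - P.card))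
    (ω : Outcome n) : Digraph (Fin n) where
  Adj u v := u ≠ v ∧ (ω s(u, v)).1 = true ∧
    if h : u ∉ P ∧ v ∉ P then σ ⟨u, h.1⟩ < σ ⟨v, h.2⟩
    else (ω s(u, v)).2 = decide (u < v)

end PlantedFVS

/-! A cycle avoiding `P` would increase forever in the ordering, so `P` is always a hitting set. If
another hitting set `H` has `|H| ≤ |P|`, put `A = P \ H` and `B = H \ P`: then `A` is nonempty, `|B|
≤ |A|`, and no `k`-cycle lives on `A` together with the vertices outside `P ∪ B`
(`exists_exchange_of_not_smallest`). It remains to rule out all such pairs `(A, B)` by a union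
bound.

For a fixed pair, only cycles with one vertex in `A` and the other `k - 1` in consecutive blocks,
each of size `m` of order `n`, of the ordering outside `P ∪ B` are considered
(`exists_cyclic_partition`). Each pair of vertices is then wanted in at most one direction, and each
wanted arc is present with probability exactly `p`: as `2p · 1/2` if it meets `P`, as a forward arc
otherwise. So the problem becomes one about independent Bernoulli(`p`) pairs (`measureReal_pi_comp`,
`measureReal_orientedBit`).

There Janson's inequality (`janson`) applies. Its correlation term is governed by the least expected
number of copies of a piece of the cycle having an edge; in the present range of `p` a single edge
at `A` gives the lower bound `a * m * p` with `a = min |A| m`. Hence the pair `(A, B)` is bad with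
probability at most `y ^ (2|A|) ≤ y ^ |A| * y ^ |B|`, where `-log y` is of order at least `n p`,
hence at least `n ^ (2/k)`. Summing over `A ≠ ∅` and `B` gives at most `((1 + y) ^ n - 1) * (1 + y)
^ n`, which tends to `0` because `n y` does. -/

namespace PlantedFVS

/-! ### Janson's inequality for products of Bernoulli variables -/

section Janson

set_option linter.unusedSectionVars false

variable {ι : Type*} [Fintype ι] [DecidableEq ι]

/-- The probability of `ω` when all coordinates are independent and `true` with probability `p`. -/
noncomputable def bernoulliWeight (p : ℝ) (ω : ι → Bool) : ℝ :=
  ∏ e, if ω e = true then p else 1 - p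

/-- The expectation of `f` when all coordinates are independent and `true` with
probability `p`. -/
noncomputable def bernoulliExp (p : ℝ) (f : (ι → Bool) → ℝ) : ℝ :=
  ∑ ω, bernoulliWeight p ω * f ω

/-- The indicator of the event that all coordinates in `F` are `true`. -/
noncomputable def allTrue (F : Finset ι) (ω : ι → Bool) : ℝ :=
  if ∀ e ∈ F, ω e = true then 1 else 0

/-- `h` does not increase when a coordinate is switched from `false` to `true`. -/
def CoordAntitone (h : (ι → Bool) → ℝ) : Prop :=
  ∀ ω e, h (Function.update ω e true) ≤ h (Function.update ω e false)

lemma bernoulliWeight_nonneg {p : ℝ} (h0 : 0 ≤ p) (h1 : p ≤ 1) (ω : ι → Bool) :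
    0 ≤ bernoulliWeight p ω :=
  Finset.prod_nonneg fun e _ => by split_ifs <;> linarith

lemma bernoulliExp_mono {p : ℝ} (h0 : 0 ≤ p) (h1 : p ≤ 1) {f g : (ι → Bool) → ℝ}
    (hfg : ∀ ω, f ω ≤ g ω) : bernoulliExp p f ≤ bernoulliExp p g :=
  Finset.sum_le_sum fun ω _ => mul_le_mul_of_nonneg_left (hfg ω) (bernoulliWeight_nonneg h0 h1 ω)

lemma bernoulliExp_one (p : ℝ) : bernoulliExp p (fun _ : ι → Bool => 1) = 1 := by
  have h := Finset.prod_univ_sum (fun _ : ι => (Finset.univ : Finset Bool))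
    (fun _ b => if b = true then p else 1 - p)
  simp only [Fintype.piFinset_univ, Fintype.sum_bool] at h
  simp only [bernoulliExp, bernoulliWeight, mul_one]
  rw [← h]
  simp

lemma bernoulliExp_sub (p : ℝ) (f g : (ι → Bool) → ℝ) :
    bernoulliExp p (fun ω => f ω - g ω) = bernoulliExp p f - bernoulliExp p g := by
  simp [bernoulliExp, mul_sub, Finset.sum_sub_distrib]

lemma bernoulliExp_const_mul (p c : ℝ) (f : (ι → Bool) → ℝ) :
    bernoulliExp p (fun ω => c * f ω) = c * bernoulliExp p f := by
  simp only [bernoulliExp, Finset.mul_sum]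
  exact Finset.sum_congr rfl fun _ _ => by ring

lemma bernoulliExp_sum {α : Type*} (p : ℝ) (s : Finset α) (f : α → (ι → Bool) → ℝ) :
    bernoulliExp p (fun ω => ∑ i ∈ s, f i ω) = ∑ i ∈ s, bernoulliExp p (f i) := by
  simp only [bernoulliExp, Finset.mul_sum]
  exact Finset.sum_comm

/-- Harris' inequality for one coordinate. The difference of the two sides is `p (1 - p)` times a
sum, over the configurations, of `± h` weighted by the other coordinates; pairing each configuration
with its flip at `e` makes every pair contribute at most `0`. -/
lemma bernoulliExp_coord_mul_le {p : ℝ} (h0 : 0 ≤ p) (h1 : p ≤ 1) (e : ι)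
    {h : (ι → Bool) → ℝ}
    (hh : ∀ ω, h (Function.update ω e true) ≤ h (Function.update ω e false)) :
    bernoulliExp p (fun ω => (if ω e = true then 1 else 0) * h ω) ≤ p * bernoulliExp p h := by
  set W : (ι → Bool) → ℝ := fun ω => ∏ j ∈ Finset.univ.erase e, if ω j = true then p else 1 - p
    with hW
  have hW0 : ∀ ω, 0 ≤ W ω := fun ω =>
    Finset.prod_nonneg fun e _ => by split_ifs <;> linarith
  have hw : ∀ ω, bernoulliWeight p ω = (if ω e = true then p else 1 - p) * W ω := fun ω =>
    (Finset.mul_prod_erase Finset.univ (fun j => if ω j = true then p else 1 - p)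
      (Finset.mem_univ e)).symm
  set flip : (ι → Bool) → (ι → Bool) := fun ω => Function.update ω e (!ω e) with hflip
  have hinv : Function.Involutive flip := by
    intro ω
    simp [hflip]
  have hWf : ∀ ω, W (flip ω) = W ω := fun ω => Finset.prod_congr rfl fun j hj => by
    simp [hflip, Function.update_of_ne (Finset.ne_of_mem_erase hj)]
  set g : (ι → Bool) → ℝ := fun ω => W ω * ((if ω e = true then 1 else -1) * h ω) with hg
  have hsum : ∑ ω, g (flip ω) = ∑ ω, g ω := Equiv.sum_comp hinv.toPerm g
  have hpair : ∀ ω, g ω + g (flip ω) ≤ 0 := by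
    intro ω
    simp only [hg, hWf]
    rw [← mul_add]
    refine mul_nonpos_of_nonneg_of_nonpos (hW0 ω) ?_
    have := hh ω
    cases hb : ω e
    · have h2 : Function.update ω e false = ω := by rw [← hb]; simp
      simp only [hflip, hb, Bool.not_false, Function.update_self]
      rw [h2] at this
      simp
      linarith
    · have h2 : Function.update ω e true = ω := by rw [← hb]; simp
      simp only [hflip, hb, Bool.not_true, Function.update_self]
      rw [h2] at this
      simp
      linarith
  have hle : ∑ ω, g ω ≤ 0 := by
    have : ∑ ω, (g ω + g (flip ω)) ≤ 0 := Finset.sum_nonpos fun ω _ => hpair ω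
    rw [Finset.sum_add_distrib, hsum] at this
    linarith
  have hkey : bernoulliExp p (fun ω => (if ω e = true then 1 else 0) * h ω)
      - p * bernoulliExp p h = p * (1 - p) * ∑ ω, g ω := by
    simp only [bernoulliExp, Finset.mul_sum, ← Finset.sum_sub_distrib, hw, hg]
    refine Finset.sum_congr rfl fun ω _ => ?_
    split_ifs <;> ring
  have : p * (1 - p) * ∑ ω, g ω ≤ 0 :=
    mul_nonpos_of_nonneg_of_nonpos (mul_nonneg h0 (by linarith)) hle
  linarith

lemma bernoulliExp_coord_mul_eq {p : ℝ} (h0 : 0 ≤ p) (h1 : p ≤ 1) (e : ι)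
    {h : (ι → Bool) → ℝ} (hh : ∀ ω b, h (Function.update ω e b) = h ω) :
    bernoulliExp p (fun ω => (if ω e = true then 1 else 0) * h ω) = p * bernoulliExp p h := by
  refine le_antisymm (bernoulliExp_coord_mul_le h0 h1 e fun ω => by rw [hh, hh]) ?_
  have := bernoulliExp_coord_mul_le h0 h1 e (h := fun ω => (-1) * h ω)
    fun ω => by simp only [hh, le_refl]
  have h2 : (fun ω : ι → Bool => (if ω e = true then (1 : ℝ) else 0) * ((-1) * h ω))
      = fun ω => (-1) * ((if ω e = true then 1 else 0) * h ω) := by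
    funext ω; ring
  rw [h2, bernoulliExp_const_mul, bernoulliExp_const_mul] at this
  linarith

lemma allTrue_nonneg (F : Finset ι) (ω : ι → Bool) : 0 ≤ allTrue F ω := by
  unfold allTrue; split_ifs <;> norm_num

lemma allTrue_insert (e : ι) (F : Finset ι) (ω : ι → Bool) :
    allTrue (insert e F) ω = (if ω e = true then 1 else 0) * allTrue F ω := by
  simp only [allTrue, Finset.forall_mem_insert]
  split_ifs <;> simp_all

lemma allTrue_union (F G : Finset ι) (ω : ι → Bool) :
    allTrue (F ∪ G) ω = allTrue F ω * allTrue G ω := by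
  simp only [allTrue, Finset.forall_mem_union]
  split_ifs <;> simp_all

lemma allTrue_update {e : ι} {F : Finset ι} (he : e ∉ F) (ω : ι → Bool) (b : Bool) :
    allTrue F (Function.update ω e b) = allTrue F ω := by
  have : ∀ j ∈ F, Function.update ω e b j = ω j := fun j hj =>
    Function.update_of_ne (ne_of_mem_of_not_mem hj he) _ _
  unfold allTrue
  congr 1
  exact propext (forall₂_congr fun j hj => by rw [this j hj])

lemma allTrue_update_mono (F : Finset ι) (ω : ι → Bool) (e : ι) :
    allTrue F (Function.update ω e false) ≤ allTrue F (Function.update ω e true) := by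
  by_cases he : e ∈ F
  · have : allTrue F (Function.update ω e false) = 0 := by
      unfold allTrue
      rw [if_neg]
      intro h
      simpa using h e he
    rw [this]
    exact allTrue_nonneg _ _
  · rw [allTrue_update he, allTrue_update he]

lemma bernoulliExp_allTrue_mul_le {p : ℝ} (h0 : 0 ≤ p) (h1 : p ≤ 1) (F : Finset ι)
    {h : (ι → Bool) → ℝ} (hh : CoordAntitone h) :
    bernoulliExp p (fun ω => allTrue F ω * h ω) ≤ p ^ F.card * bernoulliExp p h := by
  induction F using Finset.induction_on with
  | empty => simp [allTrue]
  | insert e F he ih =>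
    simp only [allTrue_insert, mul_assoc]
    refine (bernoulliExp_coord_mul_le h0 h1 e (h := fun ω => allTrue F ω * h ω) ?_).trans ?_
    · intro ω
      simp only [allTrue_update he]
      exact mul_le_mul_of_nonneg_left (hh ω e) (allTrue_nonneg _ _)
    · rw [Finset.card_insert_of_notMem he, pow_succ']
      calc _ ≤ p * (p ^ F.card * bernoulliExp p h) := mul_le_mul_of_nonneg_left ih h0
        _ = _ := by ring

lemma bernoulliExp_allTrue_mul_eq {p : ℝ} (h0 : 0 ≤ p) (h1 : p ≤ 1) (F : Finset ι)
    {h : (ι → Bool) → ℝ} (hh : ∀ e ∈ F, ∀ ω b, h (Function.update ω e b) = h ω) :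
    bernoulliExp p (fun ω => allTrue F ω * h ω) = p ^ F.card * bernoulliExp p h := by
  induction F using Finset.induction_on with
  | empty => simp [allTrue]
  | insert e F he ih =>
    simp only [allTrue_insert, mul_assoc]
    rw [bernoulliExp_coord_mul_eq h0 h1 e (h := fun ω => allTrue F ω * h ω),
      ih fun j hj => hh j (Finset.mem_insert_of_mem hj), Finset.card_insert_of_notMem he, pow_succ',
      mul_assoc]
    intro ω b
    simp only [allTrue_update he, hh e (Finset.mem_insert_self e F)]

variable {α : Type*} [DecidableEq α]

/-- A weighted version of the indicator that none of the events `F i`, `i ∈ s`, occurs. -/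
noncomputable def avoidWeight (q : ℝ) (F : α → Finset ι) (s : Finset α) (ω : ι → Bool) : ℝ :=
  ∏ i ∈ s, (1 - q * allTrue (F i) ω)

lemma one_sub_mul_allTrue_nonneg {q : ℝ} (h1 : q ≤ 1) (F : Finset ι) (ω : ι → Bool) :
    0 ≤ 1 - q * allTrue F ω := by
  unfold allTrue; split_ifs <;> simp [h1]

lemma one_sub_mul_allTrue_le_one {q : ℝ} (h0 : 0 ≤ q) (F : Finset ι) (ω : ι → Bool) :
    1 - q * allTrue F ω ≤ 1 := by
  have := mul_nonneg h0 (allTrue_nonneg F ω)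
  linarith

lemma avoidWeight_nonneg {q : ℝ} (h1 : q ≤ 1) (F : α → Finset ι) (s : Finset α) (ω : ι → Bool) :
    0 ≤ avoidWeight q F s ω :=
  Finset.prod_nonneg fun i _ => one_sub_mul_allTrue_nonneg h1 (F i) ω

lemma avoidWeight_le_of_subset {q : ℝ} (h0 : 0 ≤ q) (h1 : q ≤ 1) (F : α → Finset ι)
    {s t : Finset α} (hst : s ⊆ t) (ω : ι → Bool) :
    avoidWeight q F t ω ≤ avoidWeight q F s ω := by
  have h : avoidWeight q F (t \ s) ω * avoidWeight q F s ω = avoidWeight q F t ω :=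
    Finset.prod_sdiff hst
  rw [← h]
  exact mul_le_of_le_one_left (avoidWeight_nonneg h1 F s ω)
    (Finset.prod_le_one (fun i _ => one_sub_mul_allTrue_nonneg h1 (F i) ω)
      fun i _ => one_sub_mul_allTrue_le_one h0 (F i) ω)

lemma coordAntitone_avoidWeight {q : ℝ} (h0 : 0 ≤ q) (h1 : q ≤ 1) (F : α → Finset ι)
    (s : Finset α) : CoordAntitone (avoidWeight q F s) := fun ω e =>
  Finset.prod_le_prod (fun i _ => one_sub_mul_allTrue_nonneg h1 (F i) _) fun i _ => by
    have := mul_le_mul_of_nonneg_left (allTrue_update_mono (F i) ω e) h0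
    linarith

lemma one_sub_sum_le_avoidWeight {q : ℝ} (h0 : 0 ≤ q) (h1 : q ≤ 1) (F : α → Finset ι)
    (s : Finset α) (ω : ι → Bool) :
    1 - q * ∑ i ∈ s, allTrue (F i) ω ≤ avoidWeight q F s ω := by
  induction s using Finset.induction_on with
  | empty => simp [avoidWeight]
  | insert a s ha ih =>
    have h2 : avoidWeight q F (insert a s) ω
        = (1 - q * allTrue (F a) ω) * avoidWeight q F s ω := Finset.prod_insert ha
    have h3 : avoidWeight q F s ω ≤ 1 := by
      simpa [avoidWeight] using avoidWeight_le_of_subset h0 h1 F (Finset.empty_subset s) ω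
    rw [h2, Finset.sum_insert ha]
    nlinarith [mul_nonneg h0 (allTrue_nonneg (F a) ω)]

/-- One step of the proof of Janson's inequality. The product over `s` splits into a part `g`
independent of `F a` and a part `t` of events meeting `F a`; the latter is at least `1 - q ∑ allTrue
(F j)`. The main term factors by independence, and the correction terms are bounded by Harris'
inequality since `g` is antitone. Damping by `q` keeps the correction quadratic in `q`, so that `q`
can be optimised afterwards. -/
lemma bernoulliExp_avoidWeight_insert_le {p q : ℝ} (hp0 : 0 ≤ p) (hp1 : p ≤ 1) (h0 : 0 ≤ q)
    (h1 : q ≤ 1) (F : α → Finset ι) {s : Finset α} {a : α} (ha : a ∉ s) :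
    bernoulliExp p (avoidWeight q F (insert a s)) ≤
      Real.exp (-(q * p ^ (F a).card) +
        q ^ 2 * ∑ j ∈ s with ¬ Disjoint (F a) (F j), p ^ (F a ∪ F j).card)
        * bernoulliExp p (avoidWeight q F s) := by
  set t := s.filter fun j => ¬ Disjoint (F a) (F j) with ht
  set u := s.filter fun j => Disjoint (F a) (F j) with hu
  set g := avoidWeight q F u with hgdef
  set S := ∑ j ∈ t, p ^ (F a ∪ F j).card with hS
  have hS0 : 0 ≤ S := Finset.sum_nonneg fun _ _ => pow_nonneg hp0 _
  have hsplit : ∀ ω, avoidWeight q F s ω = g ω * avoidWeight q F t ω := fun ω =>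
    (Finset.prod_filter_mul_prod_filter_not s _ _).symm
  have hins : ∀ ω, avoidWeight q F (insert a s) ω
      = avoidWeight q F s ω - q * (allTrue (F a) ω * avoidWeight q F s ω) := fun ω => by
    have : avoidWeight q F (insert a s) ω
        = (1 - q * allTrue (F a) ω) * avoidWeight q F s ω := Finset.prod_insert ha
    rw [this]; ring
  have hE0 : 0 ≤ bernoulliExp p (avoidWeight q F s) :=
    Finset.sum_nonneg fun ω _ => mul_nonneg (bernoulliWeight_nonneg hp0 hp1 ω)
      (avoidWeight_nonneg h1 F s ω)
  have hEg : bernoulliExp p (avoidWeight q F s) ≤ bernoulliExp p g :=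
    bernoulliExp_mono hp0 hp1 fun ω => avoidWeight_le_of_subset h0 h1 F (Finset.filter_subset _ _) ω
  have hga : bernoulliExp p (fun ω => allTrue (F a) ω * g ω)
      = p ^ (F a).card * bernoulliExp p g := by
    refine bernoulliExp_allTrue_mul_eq hp0 hp1 _ fun e he ω b => ?_
    refine Finset.prod_congr rfl fun j hj => ?_
    rw [allTrue_update]
    exact Finset.disjoint_left.1 (Finset.mem_filter.1 hj).2 he
  have hlow : (p ^ (F a).card - q * S) * bernoulliExp p g
      ≤ bernoulliExp p (fun ω => allTrue (F a) ω * avoidWeight q F s ω) := by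
    have e1 : ∀ ω, allTrue (F a) ω * g ω - q * ∑ j ∈ t, allTrue (F a ∪ F j) ω * g ω
        ≤ allTrue (F a) ω * avoidWeight q F s ω := by
      intro ω
      have := mul_le_mul_of_nonneg_left (one_sub_sum_le_avoidWeight h0 h1 F t ω)
        (mul_nonneg (allTrue_nonneg (F a) ω) (avoidWeight_nonneg h1 F u ω))
      rw [hsplit]
      have e2 : ∑ j ∈ t, allTrue (F a ∪ F j) ω * g ω
          = allTrue (F a) ω * g ω * ∑ j ∈ t, allTrue (F j) ω := by
        rw [Finset.mul_sum]
        exact Finset.sum_congr rfl fun j _ => by rw [allTrue_union]; ring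
      rw [e2]
      linarith
    have e3 := bernoulliExp_mono hp0 hp1 e1
    rw [bernoulliExp_sub, hga, bernoulliExp_const_mul, bernoulliExp_sum] at e3
    have e4 : ∑ j ∈ t, bernoulliExp p (fun ω => allTrue (F a ∪ F j) ω * g ω)
        ≤ S * bernoulliExp p g := by
      rw [hS, Finset.sum_mul]
      exact Finset.sum_le_sum fun j _ =>
        bernoulliExp_allTrue_mul_le hp0 hp1 _ (coordAntitone_avoidWeight h0 h1 F u)
    have := mul_le_mul_of_nonneg_left e4 h0
    linarith
  have hinsE : bernoulliExp p (avoidWeight q F (insert a s)) = bernoulliExp p (avoidWeight q F s)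
      - q * bernoulliExp p (fun ω => allTrue (F a) ω * avoidWeight q F s ω) := by
    rw [← bernoulliExp_const_mul, ← bernoulliExp_sub]
    congr 1
    funext ω
    exact hins ω
  have hexp := Real.add_one_le_exp (-(q * p ^ (F a).card) + q ^ 2 * S)
  rcases le_total 0 (p ^ (F a).card - q * S) with hc | hc
  · have e5 := mul_le_mul_of_nonneg_left
      ((mul_le_mul_of_nonneg_left hEg hc).trans hlow) h0
    have e6 := mul_le_mul_of_nonneg_right hexp hE0
    nlinarith
  -- If the lower bound is vacuous, the exponent is nonnegative and monotonicity in `s` suffices.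
  · have e7 : 1 ≤ Real.exp (-(q * p ^ (F a).card) + q ^ 2 * S) := by
      refine Real.one_le_exp ?_
      nlinarith [mul_le_mul_of_nonneg_left hc h0]
    have e8 : bernoulliExp p (avoidWeight q F (insert a s)) ≤ bernoulliExp p (avoidWeight q F s) :=
      bernoulliExp_mono hp0 hp1 fun ω =>
        avoidWeight_le_of_subset h0 h1 F (Finset.subset_insert a s) ω
    nlinarith

lemma bernoulliExp_avoidWeight_le {p q : ℝ} (hp0 : 0 ≤ p) (hp1 : p ≤ 1) (h0 : 0 ≤ q)
    (h1 : q ≤ 1) (F : α → Finset ι) (s : Finset α) :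
    bernoulliExp p (avoidWeight q F s) ≤
      Real.exp (-(q * ∑ i ∈ s, p ^ (F i).card) +
        q ^ 2 * ∑ i ∈ s, ∑ j ∈ s with ¬ Disjoint (F i) (F j), p ^ (F i ∪ F j).card) := by
  induction s using Finset.induction_on with
  | empty =>
    have : avoidWeight q F ∅ = fun _ => 1 := by funext ω; simp [avoidWeight]
    rw [this, bernoulliExp_one]
    simp
  | insert a s ha ih =>
    refine (bernoulliExp_avoidWeight_insert_le hp0 hp1 h0 h1 F ha).trans ?_
    refine (mul_le_mul_of_nonneg_left ih (Real.exp_nonneg _)).trans ?_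
    rw [← Real.exp_add]
    refine Real.exp_le_exp.2 ?_
    rw [Finset.sum_insert ha, Finset.sum_insert ha]
    have hmono : ∀ i, ∑ j ∈ s with ¬ Disjoint (F i) (F j), p ^ (F i ∪ F j).card
        ≤ ∑ j ∈ insert a s with ¬ Disjoint (F i) (F j), p ^ (F i ∪ F j).card := fun i =>
      Finset.sum_le_sum_of_subset_of_nonneg
        (Finset.filter_subset_filter _ (Finset.subset_insert a s)) fun _ _ _ => pow_nonneg hp0 _
    have e1 := Finset.sum_le_sum fun i (_ : i ∈ s) => hmono i
    have e2 := mul_le_mul_of_nonneg_left (add_le_add (hmono a) e1) (sq_nonneg q)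
    linarith

/-- **Janson's inequality**, with a constant that is not optimal. -/
theorem janson {p : ℝ} (hp0 : 0 ≤ p) (hp1 : p ≤ 1) (F : α → Finset ι) (s : Finset α) {M D : ℝ}
    (hM0 : 0 ≤ M) (hM : M ≤ ∑ i ∈ s, p ^ (F i).card) (hD0 : 0 < D)
    (hD : ∑ i ∈ s, ∑ j ∈ s with ¬ Disjoint (F i) (F j), p ^ (F i ∪ F j).card ≤ D)
    (hMD : M ≤ D) :
    bernoulliExp p (Set.indicator {ω | ∀ i ∈ s, ¬ ∀ e ∈ F i, ω e = true} fun _ => 1)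
      ≤ Real.exp (-(M ^ 2 / (4 * D))) := by
  -- This `q` minimises `-q M + q ^ 2 D`; the hypothesis `M ≤ D` keeps it at most `1`.
  set q : ℝ := M / (2 * D) with hq
  have hq0 : 0 ≤ q := by positivity
  have hq1 : q ≤ 1 := by
    rw [hq, div_le_one (by positivity)]
    linarith
  calc _ ≤ bernoulliExp p (avoidWeight q F s) := by
        refine bernoulliExp_mono hp0 hp1 fun ω => ?_
        rw [Set.indicator_apply]
        split_ifs with h
        · refine ((Finset.prod_eq_one fun i hi => ?_).symm).le
          simp only [allTrue]
          rw [if_neg (h i hi)]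
          ring
        · exact avoidWeight_nonneg hq1 F s ω
    _ ≤ _ := bernoulliExp_avoidWeight_le hp0 hp1 hq0 hq1 F s
    _ ≤ _ := by
        refine Real.exp_le_exp.2 ?_
        have e1 := mul_le_mul_of_nonneg_left hM hq0
        have e2 := mul_le_mul_of_nonneg_left hD (sq_nonneg q)
        have e3 : -(q * M) + q ^ 2 * D = -(M ^ 2 / (4 * D)) := by
          rw [hq]; field_simp; ring
        linarith

end Janson

/-! ### Transversal cycles of a cyclically partitioned set -/

section Transversal

set_option linter.unusedSectionVars false

variable {V : Type*} [DecidableEq V] {k : ℕ} [NeZero k]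

/-- The pairs joined by the closed walk `x`. -/
def cycleEdges (x : ZMod k → V) : Finset (Sym2 V) :=
  Finset.univ.image fun i => s(x i, x (i + 1))

/-- The positions at which `x` and `y` agree. -/
def agreement (x y : ZMod k → V) : Finset (ZMod k) :=
  Finset.univ.filter fun i => x i = y i

/-- The positions in `S` whose successor is in `S`. -/
def cyclicArcs (S : Finset (ZMod k)) : Finset (ZMod k) :=
  S.filter fun i => i + 1 ∈ S

lemma eq_of_mem_parts {W : ZMod k → Finset V} (hW : ∀ i j, i ≠ j → Disjoint (W i) (W j))
    {i j : ZMod k} {u : V} (hi : u ∈ W i) (hj : u ∈ W j) : i = j := by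
  by_contra h
  exact Finset.disjoint_left.1 (hW i j h) hi hj

lemma add_one_add_one_ne (hk : 3 ≤ k) (i : ZMod k) : i + 1 + 1 ≠ i := by
  intro h
  have h2 : ((2 : ℕ) : ZMod k) = 0 := by
    push_cast
    linear_combination h
  rw [ZMod.natCast_eq_zero_iff] at h2
  exact absurd (Nat.le_of_dvd (by norm_num) h2) (by omega)

lemma add_one_ne (hk : 3 ≤ k) (i : ZMod k) : i + 1 ≠ i := by
  intro h
  exact add_one_add_one_ne hk i (by rw [h, h])

/-- The parts are disjoint, so a pair reveals the positions of its ends; a match in the reverse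
sense would force `j + 2 = j` in `ZMod k`, impossible for `k ≥ 3`. -/
lemma agree_of_edge_eq (hk : 3 ≤ k) {W : ZMod k → Finset V}
    (hW : ∀ i j, i ≠ j → Disjoint (W i) (W j)) {x y : ZMod k → V} (hx : ∀ i, x i ∈ W i)
    (hy : ∀ i, y i ∈ W i) {i j : ZMod k} (h : s(x i, x (i + 1)) = s(y j, y (j + 1))) :
    i = j ∧ x i = y i ∧ x (i + 1) = y (i + 1) := by
  rw [Sym2.eq_iff] at h
  rcases h with ⟨h1, h2⟩ | ⟨h1, h2⟩
  · have : i = j := eq_of_mem_parts hW (hx i) (h1 ▸ hy j)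
    subst this
    exact ⟨rfl, h1, h2⟩
  · have e1 : i = j + 1 := eq_of_mem_parts hW (hx i) (h1 ▸ hy (j + 1))
    have e2 : i + 1 = j := eq_of_mem_parts hW (hx (i + 1)) (h2 ▸ hy j)
    exact absurd (by rw [← e1, e2]) (add_one_add_one_ne hk j)

lemma card_cycleEdges (hk : 3 ≤ k) {W : ZMod k → Finset V}
    (hW : ∀ i j, i ≠ j → Disjoint (W i) (W j)) {x : ZMod k → V} (hx : ∀ i, x i ∈ W i) :
    (cycleEdges x).card = k := by
  rw [cycleEdges, Finset.card_image_of_injective, Finset.card_univ, ZMod.card]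
  exact fun i j h => (agree_of_edge_eq hk hW hx hx h).1

lemma cycleEdges_inter_subset (hk : 3 ≤ k) {W : ZMod k → Finset V}
    (hW : ∀ i j, i ≠ j → Disjoint (W i) (W j)) {x y : ZMod k → V} (hx : ∀ i, x i ∈ W i)
    (hy : ∀ i, y i ∈ W i) :
    cycleEdges x ∩ cycleEdges y ⊆
      (cyclicArcs (agreement x y)).image fun i => s(x i, x (i + 1)) := by
  intro e he
  simp only [cycleEdges, Finset.mem_inter, Finset.mem_image, Finset.mem_univ, true_and] at he
  obtain ⟨⟨i, rfl⟩, j, hj⟩ := he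
  obtain ⟨-, h1, h2⟩ := agree_of_edge_eq hk hW hx hy hj.symm
  refine Finset.mem_image.2 ⟨i, ?_, rfl⟩
  simp [cyclicArcs, agreement, h1, h2]

lemma le_card_cycleEdges_union (hk : 3 ≤ k) {W : ZMod k → Finset V}
    (hW : ∀ i j, i ≠ j → Disjoint (W i) (W j)) {x y : ZMod k → V} (hx : ∀ i, x i ∈ W i)
    (hy : ∀ i, y i ∈ W i) :
    2 * k - (cyclicArcs (agreement x y)).card ≤ (cycleEdges x ∪ cycleEdges y).card := by
  have h1 := Finset.card_union_add_card_inter (cycleEdges x) (cycleEdges y)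
  rw [card_cycleEdges hk hW hx, card_cycleEdges hk hW hy] at h1
  have h2 := (Finset.card_le_card (cycleEdges_inter_subset hk hW hx hy)).trans
    Finset.card_image_le
  omega

lemma card_cyclicArcs_le (S : Finset (ZMod k)) : (cyclicArcs S).card ≤ k := by
  calc _ ≤ (Finset.univ : Finset (ZMod k)).card := Finset.card_le_card (Finset.subset_univ _)
    _ = k := by rw [Finset.card_univ, ZMod.card]

lemma eq_univ_of_add_one_mem {S : Finset (ZMod k)} (hS : S.Nonempty)
    (h : ∀ i ∈ S, i + 1 ∈ S) : S = Finset.univ := by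
  obtain ⟨i, hi⟩ := hS
  have key : ∀ n : ℕ, i + n ∈ S := by
    intro n
    induction n with
    | zero => simpa using hi
    | succ n ih => simpa [add_assoc] using h _ ih
  refine Finset.eq_univ_iff_forall.2 fun j => ?_
  have := key (j - i).val
  rwa [ZMod.natCast_zmod_val, add_sub_cancel] at this

/-- A proper nonempty set of positions induces a disjoint union of paths, each with one arc fewer
than vertices. -/
lemma card_cyclicArcs_lt {S : Finset (ZMod k)} (hS : S.Nonempty) (hu : S ≠ Finset.univ) :
    (cyclicArcs S).card < S.card := by
  refine Finset.card_lt_card ((Finset.filter_subset _ _).ssubset_of_ne fun h => hu ?_)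
  exact eq_univ_of_add_one_mem hS fun i hi => (Finset.filter_eq_self.1 h) i hi

lemma card_agreeing_le {W : ZMod k → Finset V} (x : ZMod k → V) (S : Finset (ZMod k)) :
    ((Fintype.piFinset W).filter fun y => agreement x y = S).card ≤ ∏ i ∈ Sᶜ, (W i).card := by
  calc _ ≤ (Fintype.piFinset fun i => if i ∈ S then {x i} else W i).card := by
        refine Finset.card_le_card fun y hy => ?_
        rw [Finset.mem_filter, Fintype.mem_piFinset] at hy
        refine Fintype.mem_piFinset.2 fun i => ?_
        split_ifs with hi
        · rw [← hy.2] at hi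
          simp only [agreement, Finset.mem_filter, Finset.mem_univ, true_and] at hi
          simp [hi]
        · exact hy.1 i
    _ = ∏ i ∈ Sᶜ, (W i).card := by
        rw [Fintype.card_piFinset, ← Finset.prod_mul_prod_compl S]
        rw [Finset.prod_eq_one, one_mul]
        · exact Finset.prod_congr rfl fun i hi => by rw [if_neg (Finset.mem_compl.1 hi)]
        · exact fun i hi => by simp [hi]

/-- For fixed `x`, the `y` are sorted by the set `S` where they agree with `x`. There are at most `∏
i ∈ Sᶜ, |W i|` of them, and the union has at least `2k` edges minus the arcs inside `S`; multiplying
by the expected count `hQ` of the shared piece completes both factors to the full cycle. The factor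
`2 ^ k` counts the sets `S`. -/
lemma sum_correlated_le (hk : 3 ≤ k) {W : ZMod k → Finset V}
    (hW : ∀ i j, i ≠ j → Disjoint (W i) (W j)) {p Q : ℝ} (hp0 : 0 ≤ p) (hp1 : p ≤ 1)
    (hQ0 : 0 < Q)
    (hQ : ∀ S : Finset (ZMod k), (cyclicArcs S).Nonempty →
      Q ≤ (∏ i ∈ S, ((W i).card : ℝ)) * p ^ (cyclicArcs S).card) :
    ∑ x ∈ Fintype.piFinset W, ∑ y ∈ Fintype.piFinset W with
        ¬ Disjoint (cycleEdges x) (cycleEdges y), p ^ (cycleEdges x ∪ cycleEdges y).card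
      ≤ 2 ^ k * ((∏ i, ((W i).card : ℝ)) * p ^ k) ^ 2 / Q := by
  set N : ℝ := ∏ i, ((W i).card : ℝ) with hN
  have hN0 : 0 ≤ N := Finset.prod_nonneg fun _ _ => Nat.cast_nonneg _
  have hx : ∀ x ∈ Fintype.piFinset W, ∑ y ∈ Fintype.piFinset W with
        ¬ Disjoint (cycleEdges x) (cycleEdges y), p ^ (cycleEdges x ∪ cycleEdges y).card
      ≤ 2 ^ k * (N * p ^ (2 * k) / Q) := by
    intro x hx
    rw [Fintype.mem_piFinset] at hx
    set T : Finset (Finset (ZMod k)) := Finset.univ.filter fun S => (cyclicArcs S).Nonempty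
    have hmaps : ∀ y ∈ (Fintype.piFinset W).filter
        (fun y => ¬ Disjoint (cycleEdges x) (cycleEdges y)), agreement x y ∈ T := by
      intro y hy
      rw [Finset.mem_filter, Fintype.mem_piFinset] at hy
      refine Finset.mem_filter.2 ⟨Finset.mem_univ _, ?_⟩
      rw [Finset.not_disjoint_iff_nonempty_inter] at hy
      exact Finset.image_nonempty.1 (hy.2.mono (cycleEdges_inter_subset hk hW hx hy.1))
    rw [← Finset.sum_fiberwise_of_maps_to hmaps]
    have hS : ∀ S ∈ T, ∑ y ∈ ((Fintype.piFinset W).filter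
        (fun y => ¬ Disjoint (cycleEdges x) (cycleEdges y))).filter (fun y => agreement x y = S),
          p ^ (cycleEdges x ∪ cycleEdges y).card ≤ N * p ^ (2 * k) / Q := by
      intro S hS
      have hS := (Finset.mem_filter.1 hS).2
      have hkS := card_cyclicArcs_le S
      have e1 : ∀ y ∈ ((Fintype.piFinset W).filter
          (fun y => ¬ Disjoint (cycleEdges x) (cycleEdges y))).filter
            (fun y => agreement x y = S),
          p ^ (cycleEdges x ∪ cycleEdges y).card ≤ p ^ (2 * k - (cyclicArcs S).card) := by
        intro y hy
        rw [Finset.mem_filter, Finset.mem_filter, Fintype.mem_piFinset] at hy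
        refine pow_le_pow_of_le_one hp0 hp1 ?_
        rw [← hy.2]
        exact le_card_cycleEdges_union hk hW hx hy.1.1
      have e2 : ((((Fintype.piFinset W).filter
          (fun y => ¬ Disjoint (cycleEdges x) (cycleEdges y))).filter
            (fun y => agreement x y = S)).card : ℝ) ≤ ∏ i ∈ Sᶜ, ((W i).card : ℝ) := by
        rw [← Nat.cast_prod]
        refine Nat.cast_le.2 ((Finset.card_le_card ?_).trans (card_agreeing_le x S))
        exact Finset.filter_subset_filter _ (Finset.filter_subset _ _)
      have e3 := Finset.sum_le_card_nsmul _ _ _ e1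
      rw [nsmul_eq_mul] at e3
      refine e3.trans ?_
      rw [le_div_iff₀ hQ0]
      have hP0 : 0 ≤ p ^ (2 * k - (cyclicArcs S).card) := pow_nonneg hp0 _
      calc _ ≤ (∏ i ∈ Sᶜ, ((W i).card : ℝ)) * p ^ (2 * k - (cyclicArcs S).card) *
              ((∏ i ∈ S, ((W i).card : ℝ)) * p ^ (cyclicArcs S).card) := by
            refine mul_le_mul (mul_le_mul_of_nonneg_right e2 hP0) (hQ S hS) hQ0.le ?_
            exact mul_nonneg (Finset.prod_nonneg fun _ _ => Nat.cast_nonneg _) hP0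
        _ = ((∏ i ∈ S, ((W i).card : ℝ)) * ∏ i ∈ Sᶜ, ((W i).card : ℝ)) *
              (p ^ (2 * k - (cyclicArcs S).card) * p ^ (cyclicArcs S).card) := by ring
        _ = N * p ^ (2 * k) := by
            rw [Finset.prod_mul_prod_compl, ← pow_add, Nat.sub_add_cancel (by omega)]
    refine (Finset.sum_le_card_nsmul _ _ _ hS).trans ?_
    rw [nsmul_eq_mul]
    refine mul_le_mul_of_nonneg_right ?_
      (div_nonneg (mul_nonneg hN0 (pow_nonneg hp0 _)) hQ0.le)
    have hT : T.card ≤ 2 ^ k := by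
      have := Finset.card_le_univ T
      rwa [Fintype.card_finset, ZMod.card] at this
    exact_mod_cast hT
  refine (Finset.sum_le_card_nsmul _ _ _ hx).trans ?_
  rw [nsmul_eq_mul, Fintype.card_piFinset, Nat.cast_prod, ← hN]
  refine le_of_eq ?_
  rw [pow_mul']
  ring

/-- A single edge at the small part `W 0` is the rarest piece. A proper `S` has at most `|S| - 1`
arcs, so `m p ≥ 1` lets all but one of them be dropped; the whole cycle has one arc more, which `h2`
compensates. -/
lemma le_prod_card_mul_pow {W : ZMod k → Finset V} {a m : ℕ}
    (ha : (W 0).card = a) (hm : ∀ i, i ≠ 0 → (W i).card = m) (ham : a ≤ m) {p : ℝ}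
    (hp0 : 0 ≤ p) (hp1 : p ≤ 1) (h1 : 1 ≤ m * p) (h2 : 1 ≤ (m : ℝ) ^ (k - 2) * p ^ (k - 1))
    (hk : 3 ≤ k) (S : Finset (ZMod k)) (hS : (cyclicArcs S).Nonempty) :
    (a : ℝ) * m * p ≤ (∏ i ∈ S, ((W i).card : ℝ)) * p ^ (cyclicArcs S).card := by
  obtain ⟨i, hi⟩ := hS
  have hi' := Finset.mem_filter.1 hi
  have hcard : 1 < S.card :=
    Finset.one_lt_card.2 ⟨i, hi'.1, i + 1, hi'.2, (add_one_ne hk i).symm⟩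
  have ham' : (a : ℝ) ≤ m := Nat.cast_le.2 ham
  have hprod : (a : ℝ) * (m : ℝ) ^ (S.card - 1) ≤ ∏ i ∈ S, ((W i).card : ℝ) := by
    by_cases h0 : (0 : ZMod k) ∈ S
    · rw [← Finset.mul_prod_erase S _ h0, ha, Finset.prod_congr rfl (g := fun _ => (m : ℝ)),
        Finset.prod_const, Finset.card_erase_of_mem h0]
      exact fun j hj => by rw [hm j (Finset.ne_of_mem_erase hj)]
    · rw [Finset.prod_congr rfl (g := fun _ => (m : ℝ)), Finset.prod_const]
      · calc _ ≤ (m : ℝ) * m ^ (S.card - 1) :=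
              mul_le_mul_of_nonneg_right ham' (by positivity)
          _ = (m : ℝ) ^ S.card := by rw [← pow_succ', Nat.sub_add_cancel (by omega)]
      · exact fun j hj => by rw [hm j (fun h => h0 (h ▸ hj))]
  by_cases hu : S = Finset.univ
  · have hSk : S.card = k := by rw [hu, Finset.card_univ, ZMod.card]
    calc (a : ℝ) * m * p ≤ a * m * p * ((m : ℝ) ^ (k - 2) * p ^ (k - 1)) :=
          le_mul_of_one_le_right (by positivity) h2
      _ = a * (m : ℝ) ^ (S.card - 1) * p ^ k := by
          obtain ⟨l, rfl⟩ : ∃ l, k = l + 2 := ⟨k - 2, by omega⟩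
          rw [hSk]
          simp only [Nat.add_sub_cancel, show l + 2 - 1 = l + 1 by omega]
          ring
      _ ≤ a * (m : ℝ) ^ (S.card - 1) * p ^ (cyclicArcs S).card :=
          mul_le_mul_of_nonneg_left (pow_le_pow_of_le_one hp0 hp1 (card_cyclicArcs_le S))
            (by positivity)
      _ ≤ _ := mul_le_mul_of_nonneg_right hprod (by positivity)
  · have hlt := card_cyclicArcs_lt ⟨i, hi'.1⟩ hu
    calc (a : ℝ) * m * p = a * (m * p) ^ 1 := by ring
      _ ≤ a * (m * p) ^ (S.card - 1) :=
          mul_le_mul_of_nonneg_left (pow_le_pow_right₀ h1 (by omega)) (by positivity)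
      _ = a * (m : ℝ) ^ (S.card - 1) * p ^ (S.card - 1) := by rw [mul_pow]; ring
      _ ≤ a * (m : ℝ) ^ (S.card - 1) * p ^ (cyclicArcs S).card :=
          mul_le_mul_of_nonneg_left (pow_le_pow_of_le_one hp0 hp1 (by omega)) (by positivity)
      _ ≤ _ := mul_le_mul_of_nonneg_right hprod (by positivity)

/-- If all pairs are independently present with probability `p`, it is unlikely that no cycle
through the parts of `W`, in cyclic order, has all its pairs present. -/
theorem bernoulliExp_no_transversal_le [Fintype V] (hk : 3 ≤ k) {W : ZMod k → Finset V}
    (hW : ∀ i j, i ≠ j → Disjoint (W i) (W j)) {a m : ℕ} (ha0 : 0 < a)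
    (ha : (W 0).card = a) (hm : ∀ i, i ≠ 0 → (W i).card = m) (ham : a ≤ m) {p : ℝ}
    (hp0 : 0 < p) (hp1 : p ≤ 1) (h1 : 1 ≤ m * p)
    (h2 : 1 ≤ (m : ℝ) ^ (k - 2) * p ^ (k - 1)) :
    bernoulliExp p (Set.indicator {ω : Sym2 V → Bool |
        ∀ x ∈ Fintype.piFinset W, ¬ ∀ e ∈ cycleEdges x, ω e = true} fun _ => 1)
      ≤ Real.exp (-((a : ℝ) * m * p / 2 ^ (k + 2))) := by
  have hm0 : 0 < m := lt_of_lt_of_le ha0 ham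
  set Q : ℝ := (a : ℝ) * m * p with hQdef
  have hQ0 : 0 < Q := by positivity
  have hQ := le_prod_card_mul_pow ha hm ham hp0.le hp1 h1 h2 hk
  set M : ℝ := (∏ i, ((W i).card : ℝ)) * p ^ k with hM
  have hM0 : 0 < M := by
    refine mul_pos (Finset.prod_pos fun i _ => ?_) (by positivity)
    by_cases hi : i = 0
    · rw [hi, ha]; exact_mod_cast ha0
    · rw [hm i hi]; exact_mod_cast hm0
  have hsum : M = ∑ x ∈ Fintype.piFinset W, p ^ (cycleEdges x).card := by
    rw [Finset.sum_congr rfl (g := fun _ => p ^ k), Finset.sum_const, nsmul_eq_mul,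
      Fintype.card_piFinset, Nat.cast_prod, hM]
    exact fun x hx => by rw [card_cycleEdges hk hW (Fintype.mem_piFinset.1 hx)]
  have hQM : Q ≤ M := by
    have hu : cyclicArcs (Finset.univ : Finset (ZMod k)) = Finset.univ :=
      Finset.filter_true_of_mem fun i _ => Finset.mem_univ _
    have h := hQ Finset.univ (by rw [hu]; exact Finset.univ_nonempty)
    rwa [hu, Finset.card_univ, ZMod.card] at h
  have h2k : (1 : ℝ) ≤ 2 ^ k := one_le_pow₀ (by norm_num)
  -- With this `D` the exponent `M ^ 2 / (4 D)` is `Q / 2 ^ (k + 2)`, whatever `M` is; `M ≤ D`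
  -- follows from `Q ≤ M`, the case of the whole cycle.
  refine (janson hp0.le hp1 cycleEdges (Fintype.piFinset W) hM0.le hsum.le
    (D := 2 ^ k * M ^ 2 / Q) (div_pos (mul_pos (pow_pos two_pos k) (pow_pos hM0 2)) hQ0)
    (sum_correlated_le hk hW hp0.le hp1 hQ0 hQ) ?_).trans (le_of_eq ?_)
  · rw [le_div_iff₀ hQ0]
    clear_value M Q
    nlinarith [mul_le_mul_of_nonneg_left hQM hM0.le, mul_pos hM0 hM0]
  · congr 2
    clear_value M Q
    field_simp
    ring

end Transversal

/-! ### From the planted measure to independent Bernoulli variables -/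

lemma measureReal_pi_comp {ι X : Type*} [Fintype ι] [DecidableEq ι] [MeasurableSpace X]
    {μ : ι → Measure X} [∀ i, IsProbabilityMeasure (μ i)] {g : ι → X → Bool}
    (hg : ∀ i, Measurable (g i)) {p : ℝ} (hp : ∀ i, (μ i).real (g i ⁻¹' {true}) = p)
    (T : Set (ι → Bool)) :
    (Measure.pi μ).real {ω | (fun i => g i (ω i)) ∈ T}
      = bernoulliExp p (T.indicator fun _ => 1) := by
  classical
  have hφ : Measurable fun (ω : ι → X) i => g i (ω i) :=
    measurable_pi_lambda _ fun i => (hg i).comp (measurable_pi_apply i)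
  have hprob : ∀ i, IsProbabilityMeasure ((μ i).map (g i)) := fun i =>
    Measure.isProbabilityMeasure_map (hg i).aemeasurable
  have hT : MeasurableSet T := T.toFinite.measurableSet
  have h1 : (Measure.pi μ).real {ω | (fun i => g i (ω i)) ∈ T}
      = (Measure.pi fun i => (μ i).map (g i)).real T := by
    rw [← Measure.pi_map_pi fun i => (hg i).aemeasurable, map_measureReal_apply hφ hT]
    rfl
  have hsing : ∀ η : ι → Bool, (Measure.pi fun i => (μ i).map (g i)).real {η}
      = bernoulliWeight p η := by
    intro η
    rw [measureReal_def, Measure.pi_singleton, ENNReal.toReal_prod]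
    refine Finset.prod_congr rfl fun i _ => ?_
    have htrue : ((μ i).map (g i)).real {true} = p := by
      rw [map_measureReal_apply (hg i) (measurableSet_singleton _), hp]
    rw [← measureReal_def]
    cases η i
    · have hc : ({false} : Set Bool) = {true}ᶜ := by ext b; cases b <;> simp
      rw [hc, probReal_compl_eq_one_sub (measurableSet_singleton _), htrue]
      simp
    · simp [htrue]
  have h2 := sum_measureReal_singleton (μ := Measure.pi fun i => (μ i).map (g i)) T.toFinset
  rw [Set.coe_toFinset] at h2
  rw [h1, ← h2, bernoulliExp]
  simp only [hsing, Set.indicator_apply, mul_ite, mul_one, mul_zero]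
  rw [← Finset.sum_filter]
  congr 1
  ext η
  simp

instance {n : ℕ} (P : Finset (Fin n)) (p : Set.Icc (0 : ℝ) (1 / 2)) :
    IsProbabilityMeasure (plantedMeasure P p) := by
  unfold plantedMeasure; infer_instance

/-- The pair `e` is adjacent, and if it meets `P` then it is oriented as prescribed by `d`. -/
def orientedBit {n : ℕ} (P : Finset (Fin n)) (d : Sym2 (Fin n) → Bool) (e : Sym2 (Fin n))
    (o : Bool × Bool) : Bool :=
  decide (o.1 = true ∧ ((∃ u ∈ P, u ∈ e) → o.2 = d e))

/-- The coin halves the adjacency probability `2p` exactly where it is used, so both kinds of pairs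
obey the same law. -/
lemma measureReal_orientedBit {n : ℕ} (P : Finset (Fin n)) (p : Set.Icc (0 : ℝ) (1 / 2))
    (d : Sym2 (Fin n) → Bool) (e : Sym2 (Fin n)) :
    ((ProbabilityTheory.bernoulliMeasure true false (adjProb P p e)).prod
      (ProbabilityTheory.bernoulliMeasure true false
        ⟨1 / 2, Set.mem_Icc.2 ⟨by norm_num, by norm_num⟩⟩)).real
      (orientedBit P d e ⁻¹' {true}) = (p : ℝ) := by
  by_cases he : ∃ u ∈ P, u ∈ e
  · have hset : orientedBit P d e ⁻¹' {true} = {true} ×ˢ {d e} := by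
      ext o
      simp [orientedBit, he, Prod.ext_iff]
    rw [hset, measureReal_prod_prod]
    have hadj : adjProb P p e
        = ⟨2 * (p : ℝ), Set.mem_Icc.2 ⟨by linarith [p.2.1], by linarith [p.2.2]⟩⟩ := if_pos he
    rw [hadj]
    have h2 : (ProbabilityTheory.bernoulliMeasure true false
        (⟨1 / 2, Set.mem_Icc.2 ⟨by norm_num, by norm_num⟩⟩ : unitInterval)).real {d e}
        = 1 / 2 := by
      cases d e
      · rw [ProbabilityTheory.bernoulliMeasure_real_apply_of_notMem_of_mem _
          (measurableSet_singleton _) (by simp) (by simp)]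
        norm_num
      · rw [ProbabilityTheory.bernoulliMeasure_real_apply_of_mem_of_notMem _
          (measurableSet_singleton _) (by simp) (by simp)]
    rw [h2, ProbabilityTheory.bernoulliMeasure_real_apply_of_mem_of_notMem _
          (measurableSet_singleton _) (by simp) (by simp)]
    simp only
    ring
  · have hset : orientedBit P d e ⁻¹' {true} = {true} ×ˢ Set.univ := by
      ext o
      simp [orientedBit, he]
    rw [hset, measureReal_prod_prod]
    have hadj : adjProb P p e = ⟨(p : ℝ), Set.mem_Icc.2 ⟨p.2.1, by linarith [p.2.2]⟩⟩ :=
      if_neg he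
    rw [hadj, ProbabilityTheory.bernoulliMeasure_real_apply_of_mem_of_notMem _
          (measurableSet_singleton _) (by simp) (by simp)]
    simp

/-- Fixes one direction per pair before the coins are seen, so that wanting an arc becomes an event
of a single coordinate. Pairs unrelated by `R` get the irrelevant default `false`. -/
lemma exists_orientation {α : Type*} [LinearOrder α] {R : α → α → Prop}
    (hR : ∀ u v, R u v → ¬ R v u) :
    ∃ d : Sym2 α → Bool, ∀ u v, R u v → d s(u, v) = decide (u < v) := by
  classical
  refine ⟨fun e => decide (∃ u v, e = s(u, v) ∧ u < v ∧ R u v), fun u v huv => ?_⟩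
  refine decide_eq_decide.2 ⟨?_, fun h => ⟨u, v, rfl, h, huv⟩⟩
  rintro ⟨u', v', he, hlt, hR'⟩
  rcases Sym2.eq_iff.1 he with ⟨rfl, rfl⟩ | ⟨rfl, rfl⟩
  · exact hlt
  · exact absurd hR' (hR _ _ huv)

/-- It is unlikely that no directed cycle passes through the parts of `W` in cyclic order. -/
theorem measureReal_no_transversal_le {n k : ℕ} [NeZero k] (hk : 3 ≤ k)
    (P : Finset (Fin n)) (σ : {v : Fin n // v ∉ P} ≃ Fin (n - P.card))
    (p : Set.Icc (0 : ℝ) (1 / 2)) {W : ZMod k → Finset (Fin n)}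
    (hW : ∀ i j, i ≠ j → Disjoint (W i) (W j))
    (hσ : ∀ i, ∀ u ∈ W i, ∀ v ∈ W (i + 1), ∀ (hu : u ∉ P) (hv : v ∉ P),
      σ ⟨u, hu⟩ < σ ⟨v, hv⟩)
    {a m : ℕ} (ha0 : 0 < a)
    (ha : (W 0).card = a) (hm : ∀ i, i ≠ 0 → (W i).card = m) (ham : a ≤ m)
    (hp0 : 0 < (p : ℝ)) (h1 : 1 ≤ m * (p : ℝ))
    (h2 : 1 ≤ (m : ℝ) ^ (k - 2) * (p : ℝ) ^ (k - 1)) :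
    (plantedMeasure P p).real {ω | ∀ c : ZMod k → Fin n, (∀ i, c i ∈ W i) →
        ¬ ∀ i, (plantedDigraph P σ ω).Adj (c i) (c (i + 1))}
      ≤ Real.exp (-((a : ℝ) * m * p / 2 ^ (k + 2))) := by
  obtain ⟨d, hd⟩ := exists_orientation (R := fun u v : Fin n => ∃ i, u ∈ W i ∧ v ∈ W (i + 1))
    (by
      rintro u v ⟨i, hu, hv⟩ ⟨j, hv', hu'⟩
      have e1 := eq_of_mem_parts hW hu hu'
      have e2 := eq_of_mem_parts hW hv hv'
      exact add_one_add_one_ne hk j (by rw [← e1, e2]))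
  refine le_trans ?_ (bernoulliExp_no_transversal_le hk hW ha0 ha hm ham hp0
    (by linarith [p.2.2]) h1 h2)
  rw [← measureReal_pi_comp (fun _ => measurable_of_countable _) (measureReal_orientedBit P p d)]
  refine measureReal_mono ?_
  intro ω hω
  simp only [Set.mem_ofPred_eq] at hω ⊢
  intro x hx hall
  rw [Fintype.mem_piFinset] at hx
  refine hω x hx fun i => ?_
  have hb := hall s(x i, x (i + 1)) (Finset.mem_image_of_mem _ (Finset.mem_univ i))
  simp only [orientedBit, decide_eq_true_eq] at hb
  refine ⟨fun h => ?_, hb.1, ?_⟩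
  · exact add_one_ne hk i (eq_of_mem_parts hW (hx i) (h ▸ hx (i + 1))).symm
  · split_ifs with h
    · exact hσ i _ (hx i) _ (hx (i + 1)) _ _
    · rw [hb.2 ?_, hd _ _ ⟨i, hx i, hx (i + 1)⟩]
      by_contra hcon
      refine h ⟨fun hu => hcon ⟨_, hu, Sym2.mem_mk_left _ _⟩,
        fun hv => hcon ⟨_, hv, Sym2.mem_mk_right _ _⟩⟩

/-! ### Partitions along the planted ordering -/

lemma exists_increasing_blocks {α : Type*} [LinearOrder α] (U : Finset α) {r m : ℕ}
    (h : r * m ≤ U.card) :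
    ∃ f : Fin r → Finset α, (∀ i, f i ⊆ U ∧ (f i).card = m) ∧
      ∀ i j, i < j → ∀ u ∈ f i, ∀ v ∈ f j, u < v := by
  have hlt : ∀ i : Fin r, ∀ t ∈ Finset.Ico (i * m) ((i + 1) * m), t < U.card := by
    intro i t ht
    have h1 : (i + 1) * m ≤ r * m := Nat.mul_le_mul_right m i.2
    have := (Finset.mem_Ico.1 ht).2
    omega
  refine ⟨fun i => ((Finset.Ico (i * m) ((i + 1) * m)).attachFin (hlt i)).map
    (U.orderEmbOfFin rfl).toEmbedding, fun i => ⟨?_, ?_⟩, ?_⟩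
  · intro u hu
    obtain ⟨t, -, rfl⟩ := Finset.mem_map.1 hu
    exact U.orderEmbOfFin_mem rfl t
  · rw [Finset.card_map, Finset.card_attachFin, Nat.card_Ico, add_mul, one_mul]
    omega
  · intro i j hij u hu v hv
    obtain ⟨t, ht, rfl⟩ := Finset.mem_map.1 hu
    obtain ⟨t', ht', rfl⟩ := Finset.mem_map.1 hv
    rw [Finset.mem_attachFin, Finset.mem_Ico] at ht ht'
    refine (U.orderEmbOfFin rfl).lt_iff_lt.2 (Fin.lt_def.2 ?_)
    have h1 : (i + 1) * m ≤ j * m := Nat.mul_le_mul_right m (Nat.succ_le_of_lt hij)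
    omega

lemma val_add_one_of_ne_zero {k : ℕ} [NeZero k] {i : ZMod k} (h : i + 1 ≠ 0) :
    (i + 1).val = i.val + 1 := by
  have hlt := ZMod.val_lt i
  have hcast : i + 1 = ((i.val + 1 : ℕ) : ZMod k) := by
    push_cast
    rw [ZMod.natCast_zmod_val]
  have hne : i.val + 1 ≠ k := by
    intro h'
    rw [hcast, h', ZMod.natCast_self] at h
    exact h rfl
  rw [hcast, ZMod.val_natCast_of_lt (by omega)]

/-- Part `0` is cut from `A`, and part `i ≠ 0` is block `i.val - 1` of the ordering restricted to
the vertices outside `P ∪ B`. The steps into and out of part `0` touch `P`, so the order condition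
never has to wrap around. -/
lemma exists_cyclic_partition {n k : ℕ} [NeZero k] (P : Finset (Fin n))
    (σ : {v : Fin n // v ∉ P} ≃ Fin (n - P.card)) {A B : Finset (Fin n)} (hA : A ⊆ P) {a m : ℕ}
    (ha : a ≤ A.card) (hm : (k - 1) * m + B.card ≤ n - P.card) :
    ∃ W : ZMod k → Finset (Fin n), (∀ i j, i ≠ j → Disjoint (W i) (W j)) ∧
      (∀ i, ∀ u ∈ W i, ∀ v ∈ W (i + 1), ∀ (hu : u ∉ P) (hv : v ∉ P),
        σ ⟨u, hu⟩ < σ ⟨v, hv⟩) ∧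
      (W 0).card = a ∧ (∀ i, i ≠ 0 → (W i).card = m) ∧ W 0 ⊆ A ∧
      ∀ i, i ≠ 0 → ∀ u ∈ W i, u ∉ P ∧ u ∉ B := by
  obtain ⟨A₀, hA₀, hcard⟩ := Finset.exists_subset_card_eq ha
  set ψ : Fin (n - P.card) ↪ Fin n :=
    σ.symm.toEmbedding.trans (Function.Embedding.subtype _) with hψ
  have hψP : ∀ j, ψ j ∉ P := fun j => (σ.symm j).2
  have hσψ : ∀ j (h : ψ j ∉ P), σ ⟨ψ j, h⟩ = j := fun j h => σ.apply_symm_apply j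
  set U : Finset (Fin (n - P.card)) := Finset.univ.filter fun j => ψ j ∉ B with hU
  have hUcard : (k - 1) * m ≤ U.card := by
    have h1 : (Finset.univ.filter fun j => ψ j ∈ B).card + U.card = n - P.card := by
      rw [hU, Finset.card_filter_add_card_filter_not, Finset.card_univ, Fintype.card_fin]
    have h2 : (Finset.univ.filter fun j => ψ j ∈ B).card ≤ B.card := by
      refine Finset.card_le_card_of_injOn ψ ?_ ψ.injective.injOn
      intro j hj
      simpa using hj
    omega
  obtain ⟨f, hf, hlt⟩ := exists_increasing_blocks U hUcard
  have hidx : ∀ i : ZMod k, i ≠ 0 → i.val - 1 < k - 1 := fun i hi => by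
    have h1 := ZMod.val_lt i
    have h2 : i.val ≠ 0 := fun h => hi ((ZMod.val_eq_zero i).1 h)
    omega
  set W : ZMod k → Finset (Fin n) := fun i =>
    if h : i = 0 then A₀ else (f ⟨i.val - 1, hidx i h⟩).map ψ with hWdef
  have hW0 : W 0 = A₀ := dif_pos rfl
  have hWi : ∀ i (h : i ≠ 0), W i = (f ⟨i.val - 1, hidx i h⟩).map ψ := fun i h => dif_neg h
  have hWP : ∀ i, i ≠ 0 → ∀ u ∈ W i, u ∉ P ∧ u ∉ B := by
    intro i hi u hu
    rw [hWi i hi] at hu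
    obtain ⟨j, hj, rfl⟩ := Finset.mem_map.1 hu
    exact ⟨hψP j, (Finset.mem_filter.1 ((hf _).1 hj)).2⟩
  have hblocks : ∀ i j, i ≠ 0 → j ≠ 0 → i.val < j.val → ∀ u ∈ W i, ∀ v ∈ W j,
      ∀ (hu : u ∉ P) (hv : v ∉ P), σ ⟨u, hu⟩ < σ ⟨v, hv⟩ := by
    intro i j hi hj hij u hu v hv huP hvP
    rw [hWi i hi] at hu
    rw [hWi j hj] at hv
    obtain ⟨s, hs, rfl⟩ := Finset.mem_map.1 hu
    obtain ⟨t, ht, rfl⟩ := Finset.mem_map.1 hv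
    rw [hσψ, hσψ]
    refine hlt _ _ (Fin.lt_def.2 ?_) s hs t ht
    have : i.val ≠ 0 := fun h => hi ((ZMod.val_eq_zero i).1 h)
    simp only
    omega
  refine ⟨W, ?_, ?_, by rw [hW0, hcard], ?_, hW0 ▸ hA₀, hWP⟩
  · intro i j hij
    rw [Finset.disjoint_left]
    intro u hu hv
    by_cases hi : i = 0
    · subst hi
      rw [hW0] at hu
      exact (hWP j hij.symm u hv).1 (hA (hA₀ hu))
    by_cases hj : j = 0
    · subst hj
      rw [hW0] at hv
      exact (hWP i hij u hu).1 (hA (hA₀ hv))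
    have huP := (hWP i hi u hu).1
    rcases lt_trichotomy i.val j.val with h | h | h
    · exact lt_irrefl _ (hblocks i j hi hj h u hu u hv huP huP)
    · exact hij (ZMod.val_injective k h)
    · exact lt_irrefl _ (hblocks j i hj hi h u hv u hu huP huP)
  · intro i u hu v hv huP hvP
    have hi : i ≠ 0 := by
      rintro rfl
      rw [hW0] at hu
      exact huP (hA (hA₀ hu))
    have hj : i + 1 ≠ 0 := by
      intro h
      rw [h, hW0] at hv
      exact hvP (hA (hA₀ hv))
    exact hblocks i (i + 1) hi hj (by rw [val_add_one_of_ne_zero hj]; omega) u hu v hv huP hvP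
  · intro i hi
    rw [hWi i hi, Finset.card_map, (hf _).2]

/-! ### The planted set hits all cycles -/

/-- On a cycle avoiding `P`, the vertex that is last in the ordering could have no successor. -/
lemma isHittingSet_planted {n k : ℕ} [NeZero k] (P : Finset (Fin n))
    (σ : {v : Fin n // v ∉ P} ≃ Fin (n - P.card)) (ω : Outcome n) :
    IsHittingSet (cycleSets (plantedDigraph P σ ω) k) P := by
  rintro T ⟨c, -, hadj, hT⟩
  by_contra hcon
  have hc : ∀ i, c i ∉ P := fun i hi =>
    hcon ⟨c i, hi, by rw [← Finset.mem_coe, hT]; exact ⟨i, rfl⟩⟩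
  obtain ⟨i, hi⟩ := Finite.exists_max fun i => σ ⟨c i, hc i⟩
  have h := (hadj i).2.2
  rw [dif_pos ⟨hc i, hc (i + 1)⟩] at h
  exact absurd (hi (i + 1)) (not_le.2 h)

/-- If `P` is not the unique smallest hitting set, then some nonempty `A ⊆ P` can be exchanged
for a set `B` that is not larger. -/
lemma exists_exchange_of_not_smallest {n k : ℕ} [NeZero k] {P : Finset (Fin n)}
    {σ : {v : Fin n // v ∉ P} ≃ Fin (n - P.card)} {ω : Outcome n}
    (h : ¬ IsTheSmallestHittingSet (cycleSets (plantedDigraph P σ ω) k) P) :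
    ∃ A B : Finset (Fin n), A ⊆ P ∧ A.Nonempty ∧ B.card ≤ A.card ∧
      ∀ T ∈ cycleSets (plantedDigraph P σ ω) k, ∃ v ∈ T, v ∉ A ∧ (v ∈ P ∨ v ∈ B) := by
  simp only [IsTheSmallestHittingSet, isHittingSet_planted, true_and, not_forall, not_lt] at h
  obtain ⟨H, hH, hne, hcard⟩ := h
  refine ⟨P \ H, H \ P, Finset.sdiff_subset, ?_, ?_, ?_⟩
  · rw [Finset.sdiff_nonempty]
    exact fun hsub => hne (Finset.eq_of_subset_of_card_le hsub hcard).symm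
  · have h1 := Finset.card_sdiff_add_card_inter P H
    have h2 := Finset.card_sdiff_add_card_inter H P
    rw [Finset.inter_comm] at h2
    omega
  · intro T hT
    obtain ⟨v, hv, hvT⟩ := hH T hT
    refine ⟨v, hvT, fun h => (Finset.mem_sdiff.1 h).2 hv, ?_⟩
    by_cases hP : v ∈ P
    · exact Or.inl hP
    · exact Or.inr (Finset.mem_sdiff.2 ⟨hv, hP⟩)

/-! ### The union bound over exchanges -/

/-- Part `0` gets `min |A| m` vertices to meet the size condition of the transversal bound. Since
`|A|` and `m` are at most `n`, this minimum is at least `|A| m / n`, which keeps the exponent linear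
in `|A|` as the union bound requires. -/
lemma measureReal_exchange_le {n k : ℕ} [NeZero k] (hk : 3 ≤ k) (P : Finset (Fin n))
    (σ : {v : Fin n // v ∉ P} ≃ Fin (n - P.card)) (p : Set.Icc (0 : ℝ) (1 / 2))
    {A B : Finset (Fin n)} (hA : A ⊆ P) (hA0 : A.Nonempty) {m : ℕ} (hm0 : 0 < m) (hmn : m ≤ n)
    (hm : (k - 1) * m + B.card ≤ n - P.card) (hp0 : 0 < (p : ℝ)) (h1 : 1 ≤ m * (p : ℝ))
    (h2 : 1 ≤ (m : ℝ) ^ (k - 2) * (p : ℝ) ^ (k - 1)) :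
    (plantedMeasure P p).real {ω | ∀ T ∈ cycleSets (plantedDigraph P σ ω) k,
        ∃ v ∈ T, v ∉ A ∧ (v ∈ P ∨ v ∈ B)}
      ≤ Real.exp (-(A.card * ((m : ℝ) ^ 2 * p / (n * 2 ^ (k + 2))))) := by
  obtain ⟨W, hW, hσ, h0, hWm, hWA, hWB⟩ :=
    exists_cyclic_partition (k := k) P σ hA (min_le_left A.card m) hm
  have hApos := hA0.card_pos
  have hAn : A.card ≤ n := by simpa using Finset.card_le_univ A
  refine le_trans (measureReal_mono ?_) ((measureReal_no_transversal_le hk P σ p hW hσ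
    (lt_min hApos hm0) h0 hWm (min_le_right _ _) hp0 h1 h2).trans ?_)
  · intro ω hω c hc hadj
    obtain ⟨v, hv, hvA, hvB⟩ := hω (Finset.univ.image c)
      ⟨c, fun i j hij => eq_of_mem_parts hW (hc i) (hij ▸ hc j), hadj, by simp⟩
    obtain ⟨i, -, rfl⟩ := Finset.mem_image.1 hv
    by_cases hi : i = 0
    · subst hi
      exact hvA (hWA (hc 0))
    · have := hWB i hi _ (hc i)
      tauto
  · refine Real.exp_le_exp.2 (neg_le_neg ?_)
    have hn0 : (0 : ℝ) < n := Nat.cast_pos.2 (lt_of_lt_of_le hm0 hmn)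
    have hmin : (A.card : ℝ) * m ≤ (min A.card m : ℕ) * (n : ℝ) := by
      rcases le_total A.card m with h | h
      · rw [min_eq_left h]
        exact mul_le_mul_of_nonneg_left (Nat.cast_le.2 hmn) (Nat.cast_nonneg _)
      · rw [min_eq_right h, mul_comm]
        exact mul_le_mul_of_nonneg_left (Nat.cast_le.2 hAn) (Nat.cast_nonneg _)
    rw [← mul_div_assoc, div_le_div_iff₀ (by positivity) (by positivity)]
    calc (A.card : ℝ) * ((m : ℝ) ^ 2 * p) * 2 ^ (k + 2)
        = (A.card * m) * (m * p * 2 ^ (k + 2)) := by ring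
      _ ≤ ((min A.card m : ℕ) * (n : ℝ)) * (m * p * 2 ^ (k + 2)) :=
          mul_le_mul_of_nonneg_right hmin (by positivity)
      _ = _ := by ring

lemma sum_pow_card_univ (n : ℕ) (y : ℝ) :
    ∑ B : Finset (Fin n), y ^ B.card = (1 + y) ^ n := by
  have h := Fintype.sum_pow_mul_eq_add_pow (Fin n) y 1
  simpa [add_comm] using h

/-- The exponent `k + 3` in place of `k + 2` halves the rate: one factor `y ^ |A|` pays for the
choice of `A`, the other, at most `y ^ |B|`, for that of `B`. Excluding `A = ∅` produces the `- 1`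
that makes the bound small. -/
lemma measureReal_not_smallest_le {n k : ℕ} [NeZero k] (hk : 3 ≤ k) (P : Finset (Fin n))
    (σ : {v : Fin n // v ∉ P} ≃ Fin (n - P.card)) (p : Set.Icc (0 : ℝ) (1 / 2))
    {m : ℕ} (hm0 : 0 < m) (hmn : m ≤ n)
    (hm : (k - 1) * m + P.card ≤ n - P.card) (hp0 : 0 < (p : ℝ)) (h1 : 1 ≤ m * (p : ℝ))
    (h2 : 1 ≤ (m : ℝ) ^ (k - 2) * (p : ℝ) ^ (k - 1)) {z : ℝ}
    (hz : n * Real.exp (-((m : ℝ) ^ 2 * p / (n * 2 ^ (k + 3)))) ≤ z) :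
    (plantedMeasure P p).real
        {ω | ¬ IsTheSmallestHittingSet (cycleSets (plantedDigraph P σ ω) k) P}
      ≤ (Real.exp z - 1) * Real.exp z := by
  classical
  set y : ℝ := Real.exp (-((m : ℝ) ^ 2 * p / (n * 2 ^ (k + 3)))) with hy
  have hy0 : 0 < y := Real.exp_pos _
  have hy1 : y ≤ 1 := Real.exp_le_one_iff.2 (neg_nonpos.2 (by positivity))
  set bad : Finset (Fin n) × Finset (Fin n) → Set (Outcome n) := fun AB =>
    {ω | ∀ T ∈ cycleSets (plantedDigraph P σ ω) k, ∃ v ∈ T, v ∉ AB.1 ∧ (v ∈ P ∨ v ∈ AB.2)}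
    with hbad
  set I : Finset (Finset (Fin n) × Finset (Fin n)) := Finset.univ.filter fun AB =>
    AB.1 ⊆ P ∧ AB.1.Nonempty ∧ AB.2.card ≤ AB.1.card with hI
  have hcover : {ω | ¬ IsTheSmallestHittingSet (cycleSets (plantedDigraph P σ ω) k) P}
      ⊆ ⋃ AB ∈ I, bad AB := by
    intro ω hω
    obtain ⟨A, B, hAP, hA0, hBA, hAB⟩ := exists_exchange_of_not_smallest hω
    exact Set.mem_iUnion₂.2 ⟨(A, B), Finset.mem_filter.2 ⟨Finset.mem_univ _, hAP, hA0, hBA⟩, hAB⟩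
  have hterm : ∀ AB ∈ I, (plantedMeasure P p).real (bad AB) ≤ y ^ AB.1.card * y ^ AB.2.card := by
    intro AB hAB
    obtain ⟨hAP, hA0, hBA⟩ := (Finset.mem_filter.1 hAB).2
    have hBP := hBA.trans (Finset.card_le_card hAP)
    refine (measureReal_exchange_le hk P σ p hAP hA0 hm0 hmn (by omega) hp0 h1 h2).trans ?_
    calc _ = y ^ AB.1.card * y ^ AB.1.card := by
          rw [hy, ← Real.exp_nat_mul, ← Real.exp_add]
          congr 1
          rw [pow_succ (2 : ℝ) (k + 2)]
          have hn0 : (n : ℝ) ≠ 0 := Nat.cast_ne_zero.2 (by omega)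
          field_simp
          ring
      _ ≤ _ := mul_le_mul_of_nonneg_left (pow_le_pow_of_le_one hy0.le hy1 hBA) (by positivity)
  have hpow : (1 + y) ^ n ≤ Real.exp z := by
    calc (1 + y) ^ n ≤ Real.exp y ^ n :=
          pow_le_pow_left₀ (by positivity) (by linarith [Real.add_one_le_exp y]) n
      _ = Real.exp (n * y) := (Real.exp_nat_mul y n).symm
      _ ≤ Real.exp z := Real.exp_le_exp.2 hz
  have hsum : ∑ A ∈ (Finset.univ : Finset (Finset (Fin n))).erase ∅, y ^ A.card
      = (1 + y) ^ n - 1 := by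
    rw [← sum_pow_card_univ, ← Finset.add_sum_erase _ _ (Finset.mem_univ ∅)]
    simp
  have h1y : 1 ≤ (1 + y) ^ n := one_le_pow₀ (by linarith)
  calc _ ≤ (plantedMeasure P p).real (⋃ AB ∈ I, bad AB) := measureReal_mono hcover (measure_ne_top _ _)
    _ ≤ ∑ AB ∈ I, (plantedMeasure P p).real (bad AB) := measureReal_biUnion_finset_le I bad
    _ ≤ ∑ AB ∈ I, y ^ AB.1.card * y ^ AB.2.card := Finset.sum_le_sum hterm
    _ ≤ ∑ AB ∈ ((Finset.univ : Finset (Finset (Fin n))).erase ∅) ×ˢ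
          (Finset.univ : Finset (Finset (Fin n))), y ^ AB.1.card * y ^ AB.2.card := by
        refine Finset.sum_le_sum_of_subset_of_nonneg ?_ fun _ _ _ => by positivity
        intro AB hAB
        have := (Finset.mem_filter.1 hAB).2.2.1
        simp [this.ne_empty]
    _ = ((1 + y) ^ n - 1) * (1 + y) ^ n := by
        rw [Finset.sum_product, ← hsum, ← sum_pow_card_univ, Finset.sum_mul_sum]
    _ ≤ _ := mul_le_mul (by linarith) hpow (by positivity) (by linarith)

/-! ### Asymptotics -/

open Filter Topology in
lemma eventually_exp_bound {c : ℝ} (hc : 0 < c) {s : ℝ} (hs : 0 < s) {ε : ℝ} (hε : 0 < ε) :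
    ∀ᶠ n : ℕ in atTop, (Real.exp (n * Real.exp (-(c * (n : ℝ) ^ s))) - 1) *
      Real.exp (n * Real.exp (-(c * (n : ℝ) ^ s))) ≤ ε := by
  have ht : Tendsto (fun n : ℕ => (n : ℝ) ^ s) atTop atTop :=
    (tendsto_rpow_atTop hs).comp tendsto_natCast_atTop_atTop
  have h1 : Tendsto (fun x : ℝ => x ^ (1 / s) * Real.exp (-c * x)) atTop (𝓝 0) :=
    tendsto_rpow_mul_exp_neg_mul_atTop_nhds_zero _ _ hc
  have h2 : Tendsto (fun n : ℕ => (n : ℝ) * Real.exp (-(c * (n : ℝ) ^ s))) atTop (𝓝 0) := by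
    refine (h1.comp ht).congr fun n => ?_
    simp only [Function.comp]
    rw [← Real.rpow_mul (Nat.cast_nonneg n), mul_one_div_cancel hs.ne', Real.rpow_one, neg_mul]
  have h3 : Tendsto (fun z : ℝ => (Real.exp z - 1) * Real.exp z) (𝓝 0) (𝓝 0) := by
    have : Continuous fun z : ℝ => (Real.exp z - 1) * Real.exp z := by fun_prop
    simpa using this.tendsto 0
  exact ((h3.comp h2).eventually (gt_mem_nhds hε)).mono fun n hn => le_of_lt hn

lemma rpow_div_split {n k : ℕ} (hn : 0 < n) :
    (n : ℝ) ^ (2 / (k : ℝ)) * (n : ℝ) ^ (1 - 2 / (k : ℝ)) = n := by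
  rw [← Real.rpow_add (Nat.cast_pos.2 hn)]
  simp

lemma rpow_div_pow {n k : ℕ} (hk : 3 ≤ k) :
    ((n : ℝ) ^ (2 / (k : ℝ))) ^ (k - 2) = ((n : ℝ) ^ (1 - 2 / (k : ℝ))) ^ 2 := by
  have hn' : (0 : ℝ) ≤ n := Nat.cast_nonneg n
  have hk' : (k : ℝ) ≠ 0 := Nat.cast_ne_zero.2 (by omega)
  rw [← Real.rpow_natCast, ← Real.rpow_natCast, ← Real.rpow_mul hn', ← Real.rpow_mul hn',
    Nat.cast_sub (by omega)]
  congr 1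
  push_cast
  field_simp

end PlantedFVS

/-! ### Choice of constants and conclusion -/

open Filter in
theorem theorem4 (k : ℕ) (hk : 3 ≤ k) (C : ℝ) (hC : 0 < C)
    (δ : ℝ) (hδ0 : 0 < δ) (hδ : δ ≤ 9 / 19) :
    ∀ ε : ℝ, 0 < ε → ∃ N : ℕ, ∀ n : ℕ, N ≤ n →
      ∀ p : Set.Icc (0 : ℝ) (1 / 2), C / (n : ℝ) ^ (1 - 2 / (k : ℝ)) ≤ (p : ℝ) →
      ∀ P : Finset (Fin n), |(P.card : ℝ) - δ * n| < 1 →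
      ∀ σ : {v : Fin n // v ∉ P} ≃ Fin (n - P.card),
        1 - ε ≤ (PlantedFVS.plantedMeasure P p).real
          {ω | PlantedFVS.IsTheSmallestHittingSet
            (PlantedFVS.cycleSets (PlantedFVS.plantedDigraph P σ ω) k) P} := by
  intro ε hε
  have : NeZero k := ⟨by omega⟩
  have hk' : (3 : ℝ) ≤ k := by exact_mod_cast hk
  have hk0 : (0 : ℝ) < k := by linarith
  have hs : 0 < 2 / (k : ℝ) := by positivity
  have hs' : 0 < 1 - 2 / (k : ℝ) := by
    rw [sub_pos, div_lt_one hk0]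
    linarith
  -- With `m ≥ n / (40 k)` and `p ≥ C / n ^ (1 - 2/k)`, `b` satisfies `m p ≥ b n ^ (2/k)`, and then
  -- `c` satisfies `m ^ 2 p / (n 2 ^ (k + 3)) ≥ c n ^ (2/k)`.
  set b : ℝ := C / (40 * k) with hb
  have hb0 : 0 < b := by positivity
  set c : ℝ := b / (40 * k * 2 ^ (k + 3)) with hc
  have hc0 : 0 < c := by positivity
  have htend : ∀ {s : ℝ}, 0 < s → Tendsto (fun n : ℕ => (n : ℝ) ^ s) atTop atTop := fun hs =>
    (tendsto_rpow_atTop hs).comp tendsto_natCast_atTop_atTop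
  -- In order, the thresholds give: the final bound `ε`, `m p ≥ 1`, `m ^ (k - 2) p ^ (k - 1) ≥ 1`,
  -- room for the blocks, and `m ≥ 1`.
  obtain ⟨N, hN⟩ := eventually_atTop.1 ((PlantedFVS.eventually_exp_bound hc0 hs hε).and
    (((htend hs).eventually_ge_atTop (1 / b)).and
      (((htend hs').eventually_ge_atTop (1 / (b ^ (k - 2) * C))).and
        ((eventually_ge_atTop 760).and (eventually_ge_atTop (40 * k))))))
  refine ⟨N, fun n hn p hp P hP σ => ?_⟩
  obtain ⟨h1, h2, h3, h4, h5⟩ := hN n hn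
  have hn0 : 0 < n := by omega
  have hnR : (0 : ℝ) < n := Nat.cast_pos.2 hn0
  set t : ℝ := (n : ℝ) ^ (2 / (k : ℝ)) with ht
  set r : ℝ := (n : ℝ) ^ (1 - 2 / (k : ℝ)) with hr
  have ht0 : 0 < t := Real.rpow_pos_of_pos hnR _
  have hr0 : 0 < r := Real.rpow_pos_of_pos hnR _
  have htr : t * r = n := PlantedFVS.rpow_div_split hn0
  have htk : t ^ (k - 2) = r ^ 2 := PlantedFVS.rpow_div_pow hk
  have hp0 : 0 < (p : ℝ) := lt_of_lt_of_le (by positivity) hp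
  set m : ℕ := n / (20 * k) with hm
  have hmle : 20 * k * m ≤ n := Nat.mul_div_le n (20 * k)
  have hmn : m ≤ n := Nat.div_le_self _ _
  have hm0 : 0 < m := Nat.div_pos (by omega) (by omega)
  have hmge : (n : ℝ) / (40 * k) ≤ m := by
    rw [div_le_iff₀ (by positivity)]
    have : n < 20 * k * (m + 1) := Nat.lt_mul_div_succ n (by omega)
    have h6 : 20 * k * (m + 1) ≤ m * (40 * k) := by nlinarith
    exact_mod_cast (this.trans_le h6).le
  -- The blocks take at most `n / 20` and `P`, `B` at most `9 n / 19 + 1` each; as `1/20 + 18/19 =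
  -- 379/380`, the two roundings fit once `n ≥ 760`.
  have hsize : (k - 1) * m + P.card ≤ n - P.card := by
    have hPle : (P.card : ℝ) ≤ 9 / 19 * n + 1 := by
      have := (abs_lt.1 hP).2
      nlinarith
    have h760 : (760 : ℝ) ≤ n := by exact_mod_cast h4
    have hkm : 20 * ((k - 1) * m) ≤ n := by
      calc 20 * ((k - 1) * m) ≤ 20 * (k * m) := by gcongr; omega
        _ ≤ n := by linarith
    have hkm' : 20 * (((k - 1) * m : ℕ) : ℝ) ≤ n := by exact_mod_cast hkm
    have : (((k - 1) * m + P.card + P.card : ℕ) : ℝ) ≤ (n : ℝ) := by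
      push_cast [Nat.cast_add] at hkm' ⊢
      linarith
    have : (k - 1) * m + P.card + P.card ≤ n := by exact_mod_cast this
    omega
  have hmp : b * t ≤ m * (p : ℝ) := by
    calc b * t = n / (40 * k) * (C / r) := by
          rw [hb, ← htr]; field_simp
      _ ≤ m * p := mul_le_mul hmge hp (by positivity) (by positivity)
  have hbt : 1 ≤ b * t := by
    rwa [div_le_iff₀ hb0, mul_comm] at h2
  -- As `t ^ (k - 2) = r ^ 2`, the quantity is at least a constant times `r`, which tends to
  -- infinity.
  have hmp2 : 1 ≤ (m : ℝ) ^ (k - 2) * (p : ℝ) ^ (k - 1) := by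
    calc (1 : ℝ) ≤ r * (b ^ (k - 2) * C) := by rwa [div_le_iff₀ (by positivity)] at h3
      _ = (b * t) ^ (k - 2) * (C / r) := by
          rw [mul_pow, htk]; field_simp
      _ ≤ (m * p) ^ (k - 2) * p :=
          mul_le_mul (pow_le_pow_left₀ (by positivity) hmp _) hp (by positivity) (by positivity)
      _ = _ := by
          rw [mul_pow, mul_assoc, ← pow_succ, show k - 2 + 1 = k - 1 by omega]
  have hexp : (n : ℝ) * Real.exp (-((m : ℝ) ^ 2 * p / (n * 2 ^ (k + 3))))
      ≤ n * Real.exp (-(c * t)) := by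
    refine mul_le_mul_of_nonneg_left (Real.exp_le_exp.2 (neg_le_neg ?_)) hnR.le
    rw [le_div_iff₀ (by positivity)]
    calc c * t * (n * 2 ^ (k + 3)) = n / (40 * k) * (b * t) := by
          rw [hc]; field_simp
      _ ≤ m * (m * p) := mul_le_mul hmge hmp (by positivity) (by positivity)
      _ = _ := by ring
  have hfail := (PlantedFVS.measureReal_not_smallest_le hk P σ p hm0 hmn hsize hp0
    (hbt.trans hmp) hmp2 hexp).trans h1
  have hcompl := probReal_compl_eq_one_sub (μ := PlantedFVS.plantedMeasure P p)
    (Set.toFinite {ω | PlantedFVS.IsTheSmallestHittingSet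
      (PlantedFVS.cycleSets (PlantedFVS.plantedDigraph P σ ω) k) P}).measurableSet
  rw [Set.compl_ofPred] at hcompl
  linarith
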